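/- Let $k,l,n\ge 0$ be integers with $l\le n$. Let $G_l(\mathbb{R}^n)$ be the Grassmann manifold of $l$-dimensional linear subspaces of $\mathbb{R}^n$, with the metric $\operatorname{dist}(\nu,\nu')=\|\mathbf{P}_\nu-\mathbf{P}_{\nu'}\|$ (operator norm of the difference of the orthogonal projections), and let $\mu$ be the normalized Haar measure on it, i.e. the unique Borel probability measure on $G_l(\mathbb{R}^n)$ that is invariant under the action of the orthogonal group $O(n)$ (the distribution of $U\nu_0$ for a Haar-distributed $U\in O(n)$ and a fixed $\nu_0\in G_l(\mathbb{R}^n)$). For $F:[0,\infty)\to[0,\infty)$, $\mathbf{z}\in\mathbb{R}^n$ and $T\subseteq\{1,\dots,n\}$ put $J_F(\mathbf{z}_T)=\sum_{i\in T}F(|z_i|)$. The exact recovery (ERC) set of $F$ is, through the null space property, $$\Omega_F=\{\nu\in G_l(\mathbb{R}^n) : J_F(\mathbf{z}_T)<J_F(\mathbf{z}_{T^c})\ \text{ for all } \mathbf{z}\in\nu\setminus\{\mathbf{0}\} \text{ and all } T\subseteq\{1,\dots,n\} \text{ with } |T|\le k\}.$$ Let $\alpha>0$, let $\Omega_{\mathrm{ZAP}}$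 be the set $\Omega_F$ for the ZAP (minimax concave penalty) sparseness measure $$F(x)=\begin{cases}2\alpha x-\alpha^2x^2, & 0\le x<1/\alpha,\\ 1, & x\ge 1/\alpha,\end{cases}$$ and let $\Omega_{\ell_1}$ be the set $\Omega_F$ for $F(x)=x$. Then $$\mu(\Omega_{\mathrm{ZAP}})=\mu(\Omega_{\ell_1}).$$ -/

import Mathlib

open MeasureTheory

/-- `ℝⁿ` with its Euclidean norm. -/
abbrev Rn (n : ℕ) : Type := EuclideanSpace ℝ (Fin n)

/-! ### The Grassmann manifold -/

/-- The Grassmann manifold `G_l(ℝⁿ)`: the `l`-dimensional linear subspaces of `ℝⁿ`. -/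
@[ext]
structure Grassmann (n l : ℕ) where
  plane : Submodule ℝ (Rn n)
  finrank_plane : Module.finrank ℝ plane = l

namespace Grassmann

/-- The orthogonal projection `P_ν` of `ℝⁿ` onto `ν`. -/
noncomputable def proj {n l : ℕ} (ν : Grassmann n l) : Rn n →L[ℝ] Rn n :=
  ν.plane.starProjection

theorem proj_injective {n l : ℕ} :
    Function.Injective (proj : Grassmann n l → Rn n →L[ℝ] Rn n) := by
  intro ν ν' h
  apply Grassmann.ext
  exact Submodule.starProjection_inj.1 h

/-- The metric `dist ν ν' = ‖P_ν - P_ν'‖`, with the operator norm. -/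
noncomputable instance instMetric (n l : ℕ) : MetricSpace (Grassmann n l) :=
  MetricSpace.induced proj proj_injective inferInstance

theorem dist_eq {n l : ℕ} (ν ν' : Grassmann n l) : dist ν ν' = ‖proj ν - proj ν'‖ :=
  dist_eq_norm (proj ν) (proj ν')

/-- The Borel σ-algebra of the metric topology. -/
noncomputable instance instMeasurable (n l : ℕ) : MeasurableSpace (Grassmann n l) :=
  borel (Grassmann n l)

instance instBorel (n l : ℕ) : BorelSpace (Grassmann n l) := ⟨rfl⟩

end Grassmann

/-! ### The orthogonal group and its normalized Haar measure -/

/-- The Borel σ-algebra of the orthogonal group `O(n)` (with the topology of `ℝ^(n × n)`). -/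
noncomputable instance instMeasurableOrthogonal (n : ℕ) :
    MeasurableSpace (Matrix.orthogonalGroup (Fin n) ℝ) :=
  borel (Matrix.orthogonalGroup (Fin n) ℝ)

instance instBorelOrthogonal (n : ℕ) : BorelSpace (Matrix.orthogonalGroup (Fin n) ℝ) := ⟨rfl⟩

instance instCompactOrthogonal (n : ℕ) : CompactSpace (Matrix.orthogonalGroup (Fin n) ℝ) := by
  refine isCompact_iff_compactSpace.1 ?_
  have hK : IsCompact (Set.pi Set.univ fun _ : Fin n => Set.pi Set.univ
      fun _ : Fin n => Set.Icc (-1 : ℝ) 1) :=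
    isCompact_univ_pi fun _ => isCompact_univ_pi fun _ => isCompact_Icc
  refine hK.of_isClosed_subset (isClosed_unitary (R := Matrix (Fin n) (Fin n) ℝ)) ?_
  intro U hU i _ j _
  exact abs_le.1 (entry_norm_bound_of_unitary (𝕜 := ℝ) hU i j)

/-- The Haar measure on the compact group `O(n)` of total mass one. -/
noncomputable def orthogonalHaar (n : ℕ) : Measure (Matrix.orthogonalGroup (Fin n) ℝ) :=
  Measure.haarMeasure ⊤

/-! ### The action of the orthogonal group and the invariant measure -/

namespace Grassmann

/-- Left multiplication by an orthogonal matrix, `ν ↦ U ν = {U z | z ∈ ν}`. -/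
noncomputable def rotate {n l : ℕ} (U : Matrix.orthogonalGroup (Fin n) ℝ) (ν : Grassmann n l) :
    Grassmann n l :=
  ⟨ν.plane.map (Matrix.toEuclideanLin U.1), by
    have hinj : Function.Injective (Matrix.toEuclideanLin U.1) := by
      intro x y h
      have h' := congrArg (fun v => Matrix.toEuclideanLin (star U.1) v) h
      have key : ∀ v : Rn n,
          Matrix.toEuclideanLin (star U.1) (Matrix.toEuclideanLin U.1 v) = v := by
        intro v
        simp [Matrix.toLpLin_apply, Matrix.mulVec_mulVec, Unitary.star_mul_self_of_mem U.2]
      simpa only [key] using h'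
    exact (LinearEquiv.finrank_eq (Submodule.equivMapOfInjective _ hinj ν.plane)).symm.trans
      ν.finrank_plane⟩

/-- The `l`-plane spanned by the first `l` standard basis vectors of `ℝⁿ`. -/
noncomputable def basePlane {n l : ℕ} (h : l ≤ n) : Grassmann n l :=
  ⟨Submodule.span ℝ (Set.range fun i : Fin l => EuclideanSpace.basisFun (Fin n) ℝ (Fin.castLE h i)),
    by
      have hli : LinearIndependent ℝ
          (fun i : Fin l => EuclideanSpace.basisFun (Fin n) ℝ (Fin.castLE h i)) :=
        (EuclideanSpace.basisFun (Fin n) ℝ).orthonormal.linearIndependent.comp _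
          (Fin.castLE_injective h)
      rw [finrank_span_eq_card hli, Fintype.card_fin]⟩

/-- The normalized Haar measure `μ` on `G_l(ℝⁿ)`: the distribution of `U ν₀`, where `U` is a Haar
distributed orthogonal matrix and `ν₀` a fixed `l`-plane. -/
noncomputable def haar {n l : ℕ} (h : l ≤ n) : Measure (Grassmann n l) :=
  (orthogonalHaar n).map fun U => rotate U (basePlane h)

theorem rotate_mul {n l : ℕ} (U V : Matrix.orthogonalGroup (Fin n) ℝ) (ν : Grassmann n l) :
    rotate (U * V) ν = rotate U (rotate V ν) := by
  apply Grassmann.ext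
  change ν.plane.map (Matrix.toEuclideanLin (U.1 * V.1)) = _
  have h : Matrix.toEuclideanLin (U.1 * V.1) =
      (Matrix.toEuclideanLin U.1).comp (Matrix.toEuclideanLin V.1) := by
    ext x
    simp [Matrix.toLpLin_apply, Matrix.mulVec_mulVec]
  rw [h, Submodule.map_comp]
  rfl

theorem proj_rotate {n l : ℕ} (U : Matrix.orthogonalGroup (Fin n) ℝ) (ν : Grassmann n l) :
    proj (rotate U ν) = Matrix.toEuclideanCLM (𝕜 := ℝ) U.1 * proj ν *
      Matrix.toEuclideanCLM (𝕜 := ℝ) (star U.1) := by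
  set A := Matrix.toEuclideanCLM (n := Fin n) (𝕜 := ℝ) with hA
  have hmem : A U.1 ∈ unitary (Rn n →L[ℝ] Rn n) := by
    rw [Unitary.mem_iff, ← map_star, ← map_mul, ← map_mul,
      Unitary.star_mul_self_of_mem U.2, Unitary.mul_star_self_of_mem U.2, map_one]
    exact ⟨rfl, rfl⟩
  ext1 x
  have h := Submodule.starProjection_map_apply
    (Unitary.linearIsometryEquiv (⟨A U.1, hmem⟩ : unitary (Rn n →L[ℝ] Rn n))) ν.plane x
  rw [map_star]
  exact h

theorem continuous_toEuclideanCLM (n : ℕ) : Continuous fun M : Matrix (Fin n) (Fin n) ℝ =>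
    Matrix.toEuclideanCLM (n := Fin n) (𝕜 := ℝ) M :=
  LinearMap.continuous_of_finiteDimensional
    (Matrix.toEuclideanCLM (n := Fin n) (𝕜 := ℝ)).toAlgEquiv.toLinearMap

/-- The orbit maps are continuous, hence measurable, so that `haar` is a genuine image measure. -/
theorem continuous_rotate {n l : ℕ} (ν : Grassmann n l) :
    Continuous fun U : Matrix.orthogonalGroup (Fin n) ℝ => rotate U ν := by
  refine continuous_induced_rng.2 ?_
  have h : (proj ∘ fun U : Matrix.orthogonalGroup (Fin n) ℝ => rotate U ν) = fun U =>
      Matrix.toEuclideanCLM (𝕜 := ℝ) U.1 * proj ν * Matrix.toEuclideanCLM (𝕜 := ℝ) (star U.1) :=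
    funext fun U => proj_rotate U ν
  rw [h]
  exact (((continuous_toEuclideanCLM n).comp continuous_subtype_val).mul continuous_const).mul
    ((continuous_toEuclideanCLM n).comp (continuous_star.comp continuous_subtype_val))

theorem continuous_rotate_right {n l : ℕ} (U : Matrix.orthogonalGroup (Fin n) ℝ) :
    Continuous (rotate U : Grassmann n l → Grassmann n l) := by
  refine continuous_induced_rng.2 ?_
  have h : (proj ∘ (rotate U : Grassmann n l → Grassmann n l)) = fun ν =>
      Matrix.toEuclideanCLM (𝕜 := ℝ) U.1 * proj ν * Matrix.toEuclideanCLM (𝕜 := ℝ) (star U.1) :=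
    funext fun ν => proj_rotate U ν
  rw [h]
  have hp : Continuous (proj : Grassmann n l → Rn n →L[ℝ] Rn n) := continuous_induced_dom
  exact (continuous_const.mul hp).mul continuous_const

/-- `μ` has total mass one. -/
instance isProbabilityMeasure_haar {n l : ℕ} (h : l ≤ n) : IsProbabilityMeasure (haar h) := by
  have : IsProbabilityMeasure (orthogonalHaar n) :=
    ⟨Measure.haarMeasure_self (K₀ := (⊤ : TopologicalSpace.PositiveCompacts _))⟩
  exact Measure.isProbabilityMeasure_map (continuous_rotate _).measurable.aemeasurable

/-- `μ` is invariant under the action of the orthogonal group. -/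
theorem map_rotate_haar {n l : ℕ} (h : l ≤ n) (U : Matrix.orthogonalGroup (Fin n) ℝ) :
    (haar h).map (rotate U) = haar h := by
  have hinv : (orthogonalHaar n).map (fun V => U * V) = orthogonalHaar n :=
    Measure.IsMulLeftInvariant.map_mul_left_eq_self (μ := Measure.haarMeasure
      (⊤ : TopologicalSpace.PositiveCompacts (Matrix.orthogonalGroup (Fin n) ℝ))) U
  rw [haar, Measure.map_map (continuous_rotate_right U).measurable
    (continuous_rotate _).measurable]
  conv_rhs => rw [← hinv]
  rw [Measure.map_map (continuous_rotate _).measurable (continuous_const_mul U).measurable]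
  congr 1
  funext V
  exact (rotate_mul U V _).symm

end Grassmann

/-! ### Cost functions and exact recovery sets -/

/-- `J(x_T) = ∑_{i ∈ T} F(|x_i|)`, for `F` a function on `[0, ∞)`. -/
def costOn {n : ℕ} (F : ℝ → ℝ) (T : Finset (Fin n)) (x : Rn n) : ℝ :=
  ∑ i ∈ T, F |x i|

/-- The exact recovery set `Ω_J(n, k, l)`, given by the null space property: the `ν ∈ G_l(ℝⁿ)` with
`J(z_T) < J(z_{Tᶜ})` for all nonzero `z ∈ ν` and all `T` with at most `k` elements. -/
def ercSet (F : ℝ → ℝ) (n k l : ℕ) : Set (Grassmann n l) :=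
  {ν | ∀ z ∈ ν.plane, z ≠ 0 → ∀ T : Finset (Fin n), T.card ≤ k → costOn F T z < costOn F Tᶜ z}

/-- The ZAP (minimax concave penalty) sparseness measure with tuning parameter `α`, on `[0, ∞)`. -/
noncomputable def zapF (α x : ℝ) : ℝ :=
  if x < 1 / α then 2 * α * x - α ^ 2 * x ^ 2 else 1

/-- The `ℓ₁` sparseness measure `F(x) = x` on `[0, ∞)`. -/
def l1F (x : ℝ) : ℝ := x

open Filter Topology

/-!
ZAP enters only as a function `F` with `F x / x` nonincreasing and a finite slope `c` at `0`. It
suffices to test the null space property on the largest coordinates of `z`, where the monotonicity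
of `F x / x` derives it for `F` from the one for `ℓ₁`. Conversely, applying the null space property
of `F` to `t z` and letting `t → 0` gives the one for `ℓ₁` with `≤` instead of `<`. The two recovery
sets therefore differ only by tight planes, those that for some `T` satisfy the weak `ℓ₁` inequality
with equality at some `z ≠ 0`.

Tight planes are null. Scaling the coordinates in `T` by `e ^ t` multiplies one side of the
inequality by `e ^ t` and keeps the other, so it carries a given plane to a tight one for at most
one `t`. For a fixed `ν₀`, the `g` in the general linear group with `g ν₀` tight thus have
uncountably many pairwise disjoint translates, hence Haar measure zero; by Fubini over
`O(n) × GL(n)` this is the statement for the measure on the Grassmann manifold.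
-/

/-! ### Sparseness measures -/

/-- A sparseness measure on `[0, ∞)`: a nondecreasing function that vanishes at `0`, is not
identically zero, and whose ratio `F x / x` is nonincreasing. Under the other conditions, "not
identically zero" amounts to positivity on `(0, ∞)`, which is the form recorded here. -/
structure IsSparsenessMeasure (F : ℝ → ℝ) : Prop where
  map_zero : F 0 = 0
  pos : ∀ {x}, 0 < x → 0 < F x
  monotoneOn : MonotoneOn F (Set.Ici 0)
  antitoneOn_div : AntitoneOn (fun x => F x / x) (Set.Ioi 0)

theorem IsSparsenessMeasure.mul_le_mul {F : ℝ → ℝ} (hF : IsSparsenessMeasure F) {x y : ℝ}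
    (hx : 0 ≤ x) (hxy : x ≤ y) : F y * x ≤ F x * y := by
  rcases hx.eq_or_lt with rfl | hx
  · simp [hF.map_zero]
  · exact (div_le_div_iff₀ (hx.trans_le hxy) hx).1
      (hF.antitoneOn_div hx (hx.trans_le hxy) hxy)

section Zap

variable {α : ℝ}

theorem zapF_eq_min_mul (hα : 0 < α) (x : ℝ) :
    zapF α x = min (α * x) 1 * (2 - min (α * x) 1) := by
  simp only [zapF, lt_div_iff₀' hα]
  split_ifs with h
  · rw [min_eq_left h.le]
    ring
  · rw [min_eq_right (not_lt.1 h)]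
    norm_num

theorem monotone_zapF (hα : 0 < α) : Monotone (zapF α) := by
  intro x y hxy
  rw [zapF_eq_min_mul hα, zapF_eq_min_mul hα]
  have hmono : min (α * x) 1 ≤ min (α * y) 1 := by gcongr
  nlinarith [min_le_right (α * y) 1]

theorem antitoneOn_zapF_div (hα : 0 < α) : AntitoneOn (fun x => zapF α x / x) (Set.Ioi 0) := by
  have hratio : ∀ x ∈ Set.Ioi (0 : ℝ),
      zapF α x / x = min α (1 / x) * (2 - min (α * x) 1) := fun x hx => by
    rw [zapF_eq_min_mul hα, mul_div_right_comm, ← min_div_div_right (le_of_lt hx),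
      mul_div_cancel_right₀ α (ne_of_gt hx)]
  intro x hx y hy hxy
  have hx0 : 0 < x := hx
  change zapF α y / y ≤ zapF α x / x
  rw [hratio x hx, hratio y hy]
  have : 0 ≤ 2 - min (α * y) 1 := by linarith [min_le_right (α * y) 1]
  gcongr

theorem isSparsenessMeasure_zapF (hα : 0 < α) : IsSparsenessMeasure (zapF α) where
  map_zero := by simp [zapF_eq_min_mul hα]
  pos {x} hx := by
    rw [zapF_eq_min_mul hα]
    exact mul_pos (by positivity) (by linarith [min_le_right (α * x) 1])
  monotoneOn := (monotone_zapF hα).monotoneOn _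
  antitoneOn_div := antitoneOn_zapF_div hα

theorem tendsto_zapF_div (hα : 0 < α) :
    Tendsto (fun x => zapF α x / x) (𝓝[>] 0) (𝓝 (2 * α)) := by
  have hlim : Tendsto (fun x => 2 * α - α ^ 2 * x) (𝓝[>] 0) (𝓝 (2 * α - α ^ 2 * 0)) :=
    (Continuous.tendsto (by fun_prop) 0).mono_left nhdsWithin_le_nhds
  rw [mul_zero, sub_zero] at hlim
  refine hlim.congr' ?_
  filter_upwards [Ioo_mem_nhdsGT (one_div_pos.2 hα)] with x ⟨hx0, hx⟩
  rw [zapF, if_pos hx]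
  field_simp

end Zap

/-! ### The largest coordinates -/

theorem exists_card_eq_forall_notMem_le {ι M : Type*} [Finite ι] [LinearOrder M] (f : ι → M)
    (T : Finset ι) : ∃ S : Finset ι, S.card = T.card ∧ ∀ i ∈ S, ∀ j ∉ S, f j ≤ f i := by
  classical
  have := Fintype.ofFinite ι
  induction T using Finset.induction_on with
  | empty => exact ⟨∅, by simp⟩
  | insert a T ha ih =>
    obtain ⟨S, hcard, hS⟩ := ih
    have hne : Sᶜ.Nonempty := by
      rw [← Finset.card_pos, Finset.card_compl, hcard, ← Finset.card_compl, Finset.card_pos]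
      exact ⟨a, Finset.mem_compl.2 ha⟩
    obtain ⟨m, hm, hmax⟩ := Finset.exists_max_image Sᶜ f hne
    refine ⟨insert m S, ?_, fun i hi j hj => ?_⟩
    · rw [Finset.card_insert_of_notMem (Finset.mem_compl.1 hm), Finset.card_insert_of_notMem ha,
        hcard]
    · have hjS : j ∉ S := fun h => hj (Finset.mem_insert_of_mem h)
      rcases Finset.mem_insert.1 hi with rfl | hi
      · exact hmax j (Finset.mem_compl.2 hjS)
      · exact hS i hi j hjS

theorem sum_le_sum_of_forall_notMem_le {ι M : Type*} [AddCommMonoid M] [LinearOrder M]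
    [IsOrderedCancelAddMonoid M] {f : ι → M} {S T : Finset ι} (hcard : S.card = T.card)
    (h : ∀ i ∈ S, ∀ j ∉ S, f j ≤ f i) : ∑ i ∈ T, f i ≤ ∑ i ∈ S, f i := by
  classical
  rw [← Finset.sum_sdiff_le_sum_sdiff]
  have hcard_sdiff : (T \ S).card = (S \ T).card := Finset.card_sdiff_comm hcard.symm
  rcases (S \ T).eq_empty_or_nonempty with hempty | hne
  · rw [hempty, Finset.card_empty, Finset.card_eq_zero] at hcard_sdiff
    rw [hempty, hcard_sdiff]
  · obtain ⟨m, hm, hmin⟩ := Finset.exists_min_image (S \ T) f hne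
    calc ∑ i ∈ T \ S, f i
        ≤ (T \ S).card • f m := Finset.sum_le_card_nsmul _ _ _ fun j hj =>
          h m (Finset.mem_sdiff.1 hm).1 j (Finset.mem_sdiff.1 hj).2
      _ = (S \ T).card • f m := by rw [hcard_sdiff]
      _ ≤ ∑ i ∈ S \ T, f i := Finset.card_nsmul_le_sum _ _ _ hmin

/-! ### Comparison of the recovery sets -/

section Cost

variable {n : ℕ} {F : ℝ → ℝ} {T : Finset (Fin n)}

theorem costOn_add_costOn_compl (F : ℝ → ℝ) (T : Finset (Fin n)) (x : Rn n) :
    costOn F T x + costOn F Tᶜ x = ∑ i, F |x i| :=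
  Finset.sum_add_sum_compl T _

theorem costOn_l1F_nonneg (T : Finset (Fin n)) (x : Rn n) : 0 ≤ costOn l1F T x :=
  Finset.sum_nonneg fun i _ => abs_nonneg (x i)

theorem continuous_costOn_l1F (T : Finset (Fin n)) : Continuous (costOn l1F T) := by
  unfold costOn l1F
  fun_prop

theorem costOn_l1F_smul (T : Finset (Fin n)) (c : ℝ) (x : Rn n) :
    costOn l1F T (c • x) = |c| * costOn l1F T x := by
  simp [costOn, l1F, abs_mul, Finset.mul_sum]

theorem costOn_l1F_pos_of_eq_compl {x : Rn n} (hx : x ≠ 0)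
    (h : costOn l1F T x = costOn l1F Tᶜ x) : 0 < costOn l1F T x := by
  refine (costOn_l1F_nonneg T x).lt_of_ne fun h0 => hx ?_
  have hsum : ∑ i, l1F |x i| = 0 := by rw [← costOn_add_costOn_compl l1F T, ← h, ← h0, add_zero]
  ext i
  exact abs_eq_zero.1
    ((Finset.sum_eq_zero_iff_of_nonneg fun i _ => abs_nonneg (x i)).1 hsum i (Finset.mem_univ i))

namespace IsSparsenessMeasure

-- With `τ` the largest modulus off `S`, the bound `F |z i| / |z i| ≤ F τ / τ` holds on `S` and is
-- reversed off `S`, so both costs compare with `F τ / τ` times the `ℓ₁` cost.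
theorem costOn_lt_costOn_compl (hF : IsSparsenessMeasure F) {S : Finset (Fin n)} {z : Rn n}
    (hS : ∀ i ∈ S, ∀ j ∉ S, |z j| ≤ |z i|) (hlt : costOn l1F S z < costOn l1F Sᶜ z) :
    costOn F S z < costOn F Sᶜ z := by
  have hpos : 0 < costOn l1F Sᶜ z := (costOn_l1F_nonneg S z).trans_lt hlt
  obtain ⟨m, hm, hmax⟩ := Finset.exists_max_image Sᶜ (fun j => |z j|)
    (Finset.nonempty_of_sum_ne_zero hpos.ne')
  have hm0 : 0 < |z m| := by
    by_contra! h
    exact hpos.not_ge (Finset.sum_nonpos fun j hj => (hmax j hj).trans h)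
  refine lt_of_mul_lt_mul_right ?_ hm0.le
  calc costOn F S z * |z m|
      ≤ F |z m| * costOn l1F S z := by
        simp only [costOn, Finset.sum_mul, Finset.mul_sum]
        exact Finset.sum_le_sum fun i hi =>
          hF.mul_le_mul hm0.le (hS i hi m (Finset.mem_compl.1 hm))
    _ < F |z m| * costOn l1F Sᶜ z := mul_lt_mul_of_pos_left hlt (hF.pos hm0)
    _ ≤ costOn F Sᶜ z * |z m| := by
        simp only [costOn, Finset.sum_mul, Finset.mul_sum]
        exact Finset.sum_le_sum fun j hj => hF.mul_le_mul (abs_nonneg _) (hmax j hj)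

theorem ercSet_l1F_subset (hF : IsSparsenessMeasure F) (n k l : ℕ) :
    ercSet l1F n k l ⊆ ercSet F n k l := by
  intro ν hν z hz hz0 T hT
  obtain ⟨S, hcard, hS⟩ := exists_card_eq_forall_notMem_le (fun i => |z i|) T
  have hTS : costOn F T z ≤ costOn F S z := sum_le_sum_of_forall_notMem_le hcard
    fun i hi j hj => hF.monotoneOn (abs_nonneg (z j)) (abs_nonneg (z i)) (hS i hi j hj)
  have hlt : costOn F S z < costOn F Sᶜ z :=
    hF.costOn_lt_costOn_compl hS (hν z hz hz0 S (hcard.trans_le hT))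
  linarith [costOn_add_costOn_compl F T z, costOn_add_costOn_compl F S z]

theorem pos_of_tendsto_div (hF : IsSparsenessMeasure F) {c : ℝ}
    (hc : Tendsto (fun x => F x / x) (𝓝[>] 0) (𝓝 c)) : 0 < c := by
  have hle : F 1 / 1 ≤ c := by
    refine ge_of_tendsto hc ?_
    filter_upwards [Ioc_mem_nhdsGT one_pos] with x hx
    exact hF.antitoneOn_div hx.1 (Set.mem_Ioi.2 one_pos) hx.2
  exact (div_pos (hF.pos one_pos) one_pos).trans_le hle

end IsSparsenessMeasure

theorem tendsto_costOn_smul_div {c : ℝ} (hF0 : F 0 = 0)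
    (hc : Tendsto (fun x => F x / x) (𝓝[>] 0) (𝓝 c)) (T : Finset (Fin n)) (z : Rn n) :
    Tendsto (fun t : ℝ => costOn F T (t • z) / t) (𝓝[>] 0) (𝓝 (c * costOn l1F T z)) := by
  simp only [costOn, Finset.sum_div, Finset.mul_sum]
  refine tendsto_finsetSum _ fun i _ => ?_
  rcases (abs_nonneg (z i)).eq_or_lt with hi | hi
  · simp [l1F, abs_eq_zero.1 hi.symm, hF0]
  have hscale : Tendsto (fun t => t * |z i|) (𝓝[>] 0) (𝓝[>] 0) := by
    refine tendsto_nhdsWithin_iff.2 ⟨?_, ?_⟩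
    · simpa using ((continuous_mul_const |z i|).tendsto 0).mono_left nhdsWithin_le_nhds
    · filter_upwards [self_mem_nhdsWithin] with t ht using mul_pos ht hi
  refine ((hc.comp hscale).mul_const |z i|).congr' ?_
  filter_upwards [self_mem_nhdsWithin] with t ht
  have ht0 : 0 < t := ht
  rw [PiLp.smul_apply, smul_eq_mul, abs_mul, abs_of_pos ht0, Function.comp_apply]
  field_simp

theorem IsSparsenessMeasure.costOn_l1F_le_of_mem_ercSet (hF : IsSparsenessMeasure F) {c : ℝ}
    (hc : Tendsto (fun x => F x / x) (𝓝[>] 0) (𝓝 c)) {k l : ℕ} {ν : Grassmann n l}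
    (hν : ν ∈ ercSet F n k l) (hT : T.card ≤ k) {z : Rn n} (hz : z ∈ ν.plane) :
    costOn l1F T z ≤ costOn l1F Tᶜ z := by
  rcases eq_or_ne z 0 with rfl | hz0
  · simp [costOn, l1F]
  have hlim (R : Finset (Fin n)) := tendsto_costOn_smul_div hF.map_zero hc R z
  refine le_of_mul_le_mul_left (le_of_tendsto_of_tendsto (hlim T) (hlim Tᶜ) ?_)
    (hF.pos_of_tendsto_div hc)
  filter_upwards [self_mem_nhdsWithin] with t ht
  have ht0 : 0 < t := ht
  have hlt := hν (t • z) (ν.plane.smul_mem t hz) (smul_ne_zero ht0.ne' hz0) T hT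
  gcongr

/-- The null space property for `T` and the `ℓ₁` norm holds on `S` in its weak form and fails in its
strict form. -/
def IsTight (T : Finset (Fin n)) (S : Submodule ℝ (Rn n)) : Prop :=
  (∀ z ∈ S, costOn l1F T z ≤ costOn l1F Tᶜ z) ∧
    ∃ z ∈ S, z ≠ 0 ∧ costOn l1F T z = costOn l1F Tᶜ z

theorem IsSparsenessMeasure.ercSet_diff_subset (hF : IsSparsenessMeasure F) {c : ℝ}
    (hc : Tendsto (fun x => F x / x) (𝓝[>] 0) (𝓝 c)) (n k l : ℕ) :
    ercSet F n k l \ ercSet l1F n k l ⊆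
      ⋃ T : Finset (Fin n), {ν : Grassmann n l | IsTight T ν.plane} := by
  rintro ν ⟨hν, hν'⟩
  simp only [ercSet, Set.mem_ofPred_eq, not_forall, not_lt] at hν'
  obtain ⟨z, hz, hz0, T, hT, hle⟩ := hν'
  exact Set.mem_iUnion.2 ⟨T, fun w hw => hF.costOn_l1F_le_of_mem_ercSet hc hν hT hw,
    z, hz, hz0, (hF.costOn_l1F_le_of_mem_ercSet hc hν hT hz).antisymm hle⟩

end Cost

/-! ### Left-invariant measures on groups -/

section InvariantMeasure

variable {G : Type*} [Group G] [MeasurableSpace G] [MeasurableMul G] (η : Measure G) [SFinite η]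
  [η.IsMulLeftInvariant]

theorem measure_eq_zero_of_pairwise_disjoint_preimage_mul {ι : Type*} [Uncountable ι] {D : Set G}
    (hD : MeasurableSet D) (f : ι → G)
    (hdisj : Pairwise (Function.onFun Disjoint fun i => (f i * ·) ⁻¹' D)) : η D = 0 := by
  have hcountable := Measure.countable_meas_pos_of_disjoint_iUnion (μ := η)
    (fun i => measurable_const_mul (f i) hD) hdisj
  simp only [measure_preimage_mul] at hcountable
  by_contra h
  have huniv : (Set.univ : Set ι).Countable := hcountable.mono fun i _ => pos_iff_ne_zero.2 h
  exact Set.not_countable_univ huniv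

-- Fubini for `{(k, g) | φ k • g • x ∈ E}`.
theorem measure_setOf_smul_mem {K X : Type*} [MeasurableSpace K] [MeasurableSpace X]
    [MulAction G X] (κ : Measure K) [IsProbabilityMeasure κ] {μ : Measure X} {φ : K → G} {x : X}
    (hφ : Measurable fun p : K × G => φ p.1 • p.2 • x)
    (hμ : ∀ g : G, κ.map (fun k => φ k • g • x) = μ) {E : Set X} (hE : MeasurableSet E) :
    η {g | g • x ∈ E} = μ E * η Set.univ := by
  have hleft (k : K) : η {g | φ k • g • x ∈ E} = η {g | g • x ∈ E} := by
    simp only [← mul_smul]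
    exact measure_preimage_mul η (φ k) {g | g • x ∈ E}
  have hright (g : G) : κ {k | φ k • g • x ∈ E} = μ E := by
    have hmeas : Measurable fun k => φ k • g • x := hφ.comp measurable_prodMk_right
    rw [← hμ g, Measure.map_apply hmeas hE]
    rfl
  calc η {g | g • x ∈ E}
      = ∫⁻ k, η {g | φ k • g • x ∈ E} ∂κ := by simp [hleft]
    _ = (κ.prod η) {p | φ p.1 • p.2 • x ∈ E} := (Measure.prod_apply (hφ hE)).symm
    _ = ∫⁻ g, κ {k | φ k • g • x ∈ E} ∂η := Measure.prod_apply_symm (hφ hE)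
    _ = μ E * η Set.univ := by simp [hright]

end InvariantMeasure

/-! ### The action of the general linear group on the Grassmann manifold -/

instance instBorelSpaceUnits {R : Type*} [NormedRing R] [HasSummableGeomSeries R]
    [MeasurableSpace R] [BorelSpace R] : BorelSpace Rˣ where
  measurable_eq := by
    rw [Units.isOpenEmbedding_val.isInducing.eq_induced, borel_comap,
      ← BorelSpace.measurable_eq (α := R)]
    rfl

instance instSecondCountableTopologyUnits {R : Type*} [NormedRing R] [HasSummableGeomSeries R]
    [SecondCountableTopology R] : SecondCountableTopology Rˣ :=
  Units.isOpenEmbedding_val.isEmbedding.secondCountableTopology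

section StarProjection

variable {𝕜 E : Type*} [RCLike 𝕜] [NormedAddCommGroup E] [InnerProductSpace 𝕜 E]

theorem norm_starProjection_sub_le [CompleteSpace E] (K L : Submodule 𝕜 E)
    [K.HasOrthogonalProjection] [L.HasOrthogonalProjection] :
    ‖K.starProjection - L.starProjection‖ ≤
      ‖Lᗮ.starProjection * K.starProjection‖ + ‖Kᗮ.starProjection * L.starProjection‖ := by
  have hsub : K.starProjection - L.starProjection =
      Lᗮ.starProjection * K.starProjection - L.starProjection * Kᗮ.starProjection := by
    rw [Submodule.starProjection_orthogonal', Submodule.starProjection_orthogonal']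
    noncomm_ring
  have hstar : star (L.starProjection * Kᗮ.starProjection) =
      Kᗮ.starProjection * L.starProjection := by
    rw [star_mul, (isSelfAdjoint_starProjection L).star_eq,
      (isSelfAdjoint_starProjection Kᗮ).star_eq]
  rw [hsub, ← hstar, ContinuousLinearMap.star_eq_adjoint, LinearIsometryEquiv.norm_map]
  exact norm_sub_le _ _

theorem norm_starProjection_orthogonal_map_mul_le (S : Submodule 𝕜 E) (g h : (E →L[𝕜] E)ˣ)
    [(S.map (g : E →L[𝕜] E).toLinearMap).HasOrthogonalProjection]
    [(S.map (h : E →L[𝕜] E).toLinearMap).HasOrthogonalProjection] :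
    ‖(S.map (h : E →L[𝕜] E).toLinearMap)ᗮ.starProjection *
        (S.map (g : E →L[𝕜] E).toLinearMap).starProjection‖ ≤
      ‖(g - h : E →L[𝕜] E)‖ * ‖(↑g⁻¹ : E →L[𝕜] E)‖ := by
  set P := (S.map (g : E →L[𝕜] E).toLinearMap).starProjection
  set Q := (S.map (h : E →L[𝕜] E).toLinearMap)ᗮ.starProjection
  have hker : Q * (h * (↑g⁻¹ * P)) = 0 := by
    ext x
    obtain ⟨s, hs, hsx⟩ : P x ∈ S.map (g : E →L[𝕜] E).toLinearMap :=
      Submodule.starProjection_apply_mem _ x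
    have hinv : (↑g⁻¹ : E →L[𝕜] E) (P x) = s := by
      rw [← hsx]
      exact DFunLike.congr_fun g.inv_mul s
    change Q ((h : E →L[𝕜] E) ((↑g⁻¹ : E →L[𝕜] E) (P x))) = 0
    rw [hinv, Submodule.starProjection_orthogonal_apply_eq_zero]
    exact Submodule.mem_map_of_mem hs
  have hPQ : Q * P = Q * ((g - h) * ↑g⁻¹) * P := by
    rw [sub_mul, Units.mul_inv, mul_sub, sub_mul, mul_one, mul_assoc Q, mul_assoc _ _ P, hker,
      sub_zero]
  calc ‖Q * P‖ ≤ ‖Q‖ * ‖((g - h) * ↑g⁻¹ : E →L[𝕜] E)‖ * ‖P‖ := by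
        rw [hPQ]
        exact norm_mul₃_le
    _ ≤ 1 * (‖(g - h : E →L[𝕜] E)‖ * ‖(↑g⁻¹ : E →L[𝕜] E)‖) * 1 := by
        gcongr
        · exact Submodule.starProjection_norm_le _
        · exact norm_mul_le _ _
        · exact Submodule.starProjection_norm_le _
    _ = _ := by rw [one_mul, mul_one]

end StarProjection

theorem exists_linearIsometryEquiv_map_eq {𝕜 V : Type*} [RCLike 𝕜] [NormedAddCommGroup V]
    [InnerProductSpace 𝕜 V] [FiniteDimensional 𝕜 V] {S S' : Submodule 𝕜 V}
    (h : Module.finrank 𝕜 S = Module.finrank 𝕜 S') :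
    ∃ W : V ≃ₗᵢ[𝕜] V, S.map W.toLinearEquiv.toLinearMap = S' := by
  let e : S ≃ₗᵢ[𝕜] S' := ((stdOrthonormalBasis 𝕜 S).reindex (finCongr h)).equiv
    (stdOrthonormalBasis 𝕜 S') (Equiv.refl _)
  let L : V →ₗᵢ[𝕜] V := (S'.subtypeₗᵢ.comp e.toLinearIsometry).extend
  refine ⟨L.toLinearIsometryEquiv rfl, Submodule.eq_of_le_of_finrank_eq ?_ ?_⟩
  · rintro _ ⟨s, hs, rfl⟩
    have hL : L s = e ⟨s, hs⟩ := LinearIsometry.extend_apply _ (⟨s, hs⟩ : S)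
    exact hL ▸ (e ⟨s, hs⟩).2
  · exact (LinearEquiv.finrank_map_eq _ S).trans h

instance isProbabilityMeasure_orthogonalHaar (n : ℕ) : IsProbabilityMeasure (orthogonalHaar n) :=
  ⟨Measure.haarMeasure_self⟩

instance isHaarMeasure_orthogonalHaar (n : ℕ) : (orthogonalHaar n).IsHaarMeasure :=
  inferInstanceAs (Measure.haarMeasure _).IsHaarMeasure

theorem map_mul_right_orthogonalHaar {n : ℕ} (V : Matrix.orthogonalGroup (Fin n) ℝ) :
    (orthogonalHaar n).map (· * V) = orthogonalHaar n := by
  have : IsProbabilityMeasure ((orthogonalHaar n).map (· * V)) :=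
    Measure.isProbabilityMeasure_map (continuous_mul_const V).measurable.aemeasurable
  exact Measure.isHaarMeasure_eq_of_isProbabilityMeasure _ _

/-- An orthogonal matrix as an element of the general linear group of `ℝⁿ`. -/
noncomputable def orthogonalToUnits (n : ℕ) :
    Matrix.orthogonalGroup (Fin n) ℝ →* (Rn n →L[ℝ] Rn n)ˣ :=
  (Units.map (Matrix.toEuclideanCLM (n := Fin n) (𝕜 := ℝ) : _ →* _)).comp Unitary.toUnits

theorem continuous_orthogonalToUnits (n : ℕ) : Continuous (orthogonalToUnits n) :=
  Units.isOpenEmbedding_val.isInducing.continuous_iff.2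
    ((Grassmann.continuous_toEuclideanCLM n).comp continuous_subtype_val)

namespace Grassmann

variable {n l : ℕ}

/-- The action of the general linear group on the Grassmann manifold, `g • ν = {g z | z ∈ ν}`. -/
noncomputable instance instMulActionUnits : MulAction (Rn n →L[ℝ] Rn n)ˣ (Grassmann n l) where
  smul g ν := ⟨ν.plane.map (g : Rn n →L[ℝ] Rn n).toLinearMap,
    ((ContinuousLinearEquiv.unitsEquiv ℝ (Rn n) g).toLinearEquiv.finrank_map_eq ν.plane).trans
      ν.finrank_plane⟩
  one_smul ν := Grassmann.ext (Submodule.map_id ν.plane)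
  mul_smul _ _ ν := Grassmann.ext (Submodule.map_comp _ _ ν.plane)

theorem plane_smul (g : (Rn n →L[ℝ] Rn n)ˣ) (ν : Grassmann n l) :
    (g • ν).plane = ν.plane.map (g : Rn n →L[ℝ] Rn n).toLinearMap := rfl

theorem rotate_eq_smul (U : Matrix.orthogonalGroup (Fin n) ℝ) (ν : Grassmann n l) :
    rotate U ν = orthogonalToUnits n U • ν := rfl

theorem continuous_smul_left (ν : Grassmann n l) :
    Continuous fun g : (Rn n →L[ℝ] Rn n)ˣ => g • ν := by
  refine continuous_iff_continuousAt.2 fun h => tendsto_iff_dist_tendsto_zero.2 ?_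
  let bound (g : (Rn n →L[ℝ] Rn n)ˣ) : ℝ :=
    ‖(g - h : Rn n →L[ℝ] Rn n)‖ * ‖(↑g⁻¹ : Rn n →L[ℝ] Rn n)‖ +
      ‖(h - g : Rn n →L[ℝ] Rn n)‖ * ‖(↑h⁻¹ : Rn n →L[ℝ] Rn n)‖
  have hdist (g : (Rn n →L[ℝ] Rn n)ˣ) : dist (g • ν) (h • ν) ≤ bound g := by
    rw [dist_eq]
    exact (norm_starProjection_sub_le _ _).trans (add_le_add
      (norm_starProjection_orthogonal_map_mul_le ν.plane g h)
      (norm_starProjection_orthogonal_map_mul_le ν.plane h g))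
  have hbound : Continuous bound := by
    have := Units.continuous_val (M := Rn n →L[ℝ] Rn n)
    have := Units.continuous_coe_inv (M := Rn n →L[ℝ] Rn n)
    fun_prop
  have hbound0 : bound h = 0 := by simp only [bound, sub_self, norm_zero, zero_mul, add_zero]
  exact squeeze_zero (fun _ => dist_nonneg) hdist (hbound0 ▸ hbound.tendsto h)

theorem exists_rotate_eq (ν ν' : Grassmann n l) :
    ∃ U : Matrix.orthogonalGroup (Fin n) ℝ, rotate U ν = ν' := by
  obtain ⟨W, hW⟩ := exists_linearIsometryEquiv_map_eq (ν.finrank_plane.trans ν'.finrank_plane.symm)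
  let A := Matrix.toEuclideanCLM (n := Fin n) (𝕜 := ℝ)
  let w : unitary (Rn n →L[ℝ] Rn n) := Unitary.linearIsometryEquiv.symm W
  let U : Matrix.orthogonalGroup (Fin n) ℝ := ⟨A.symm w.1, Unitary.map_mem A.symm w.2⟩
  have hU : (orthogonalToUnits n U : Rn n →L[ℝ] Rn n) = w.1 := A.apply_symm_apply w.1
  refine ⟨U, Grassmann.ext ?_⟩
  rw [rotate_eq_smul, plane_smul, hU, ← hW]
  rfl

theorem haar_eq_map_rotate (hl : l ≤ n) (ν : Grassmann n l) :
    haar hl = (orthogonalHaar n).map fun U => rotate U ν := by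
  obtain ⟨V, rfl⟩ := exists_rotate_eq (basePlane hl) ν
  simp only [← rotate_mul]
  conv_lhs => rw [haar, ← map_mul_right_orthogonalHaar V, Measure.map_map
    (continuous_rotate _).measurable (continuous_mul_const V).measurable]
  rfl

theorem measure_setOf_smul_mem_eq_haar_mul (hl : l ≤ n) (ν : Grassmann n l)
    (η : Measure (Rn n →L[ℝ] Rn n)ˣ) [SFinite η] [η.IsMulLeftInvariant] {E : Set (Grassmann n l)}
    (hE : MeasurableSet E) : η {g | g • ν ∈ E} = haar hl E * η Set.univ := by
  refine measure_setOf_smul_mem η (orthogonalHaar n) (φ := orthogonalToUnits n) ?_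
    (fun g => (haar_eq_map_rotate hl (g • ν)).symm) hE
  simp only [← mul_smul]
  exact ((continuous_smul_left ν).comp (((continuous_orthogonalToUnits n).comp
    continuous_fst).mul continuous_snd)).measurable

end Grassmann

/-! ### Tight planes -/

section Tight

variable {n : ℕ} {T : Finset (Fin n)} {S : Submodule ℝ (Rn n)}

theorem isClosed_setOf_isTight (l : ℕ) (T : Finset (Fin n)) :
    IsClosed {ν : Grassmann n l | IsTight T ν.plane} := by
  have hproj : Continuous (Grassmann.proj : Grassmann n l → _) := continuous_induced_dom
  have hmem (ν : Grassmann n l) (z : Rn n) : z ∈ ν.plane ↔ ν.proj z = z :=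
    Submodule.starProjection_eq_self_iff.symm
  have hweak : IsClosed {ν : Grassmann n l | ∀ z ∈ ν.plane, costOn l1F T z ≤ costOn l1F Tᶜ z} := by
    have hset : {ν : Grassmann n l | ∀ z ∈ ν.plane, costOn l1F T z ≤ costOn l1F Tᶜ z} =
        ⋂ z, {ν | costOn l1F T (ν.proj z) ≤ costOn l1F Tᶜ (ν.proj z)} := by
      ext ν
      simp only [Set.mem_ofPred_eq, Set.mem_iInter]
      refine ⟨fun h z => h _ (Submodule.starProjection_apply_mem _ z), fun h z hz => ?_⟩
      simpa only [(hmem ν z).1 hz] using h z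
    have heval (z : Rn n) : Continuous fun ν : Grassmann n l => ν.proj z := hproj.clm_apply
      continuous_const
    rw [hset]
    exact isClosed_iInter fun z => isClosed_le ((continuous_costOn_l1F T).comp (heval z))
      ((continuous_costOn_l1F Tᶜ).comp (heval z))
  have htie : IsClosed (Prod.fst '' {p : Grassmann n l × Metric.sphere (0 : Rn n) 1 |
      p.1.proj p.2 = p.2 ∧ costOn l1F T p.2 = costOn l1F Tᶜ p.2}) := by
    have hz : Continuous fun p : Grassmann n l × Metric.sphere (0 : Rn n) 1 => (p.2 : Rn n) :=
      continuous_subtype_val.comp continuous_snd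
    refine isClosedMap_fst_of_compactSpace _ (IsClosed.inter (isClosed_eq ?_ hz) (isClosed_eq
      ((continuous_costOn_l1F T).comp hz) ((continuous_costOn_l1F Tᶜ).comp hz)))
    exact (hproj.comp continuous_fst).clm_apply hz
  convert hweak.inter htie using 1
  ext ν
  refine and_congr Iff.rfl ⟨?_, ?_⟩
  · rintro ⟨z, hz, hz0, h⟩
    refine ⟨(ν, ⟨‖z‖⁻¹ • z, by simp [norm_smul, hz0]⟩), ⟨?_, ?_⟩, rfl⟩
    · exact (hmem _ _).1 (ν.plane.smul_mem _ hz)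
    · simp only [costOn_l1F_smul, h]
  · rintro ⟨⟨ν, z, hz1⟩, ⟨hz, h⟩, rfl⟩
    exact ⟨z, (hmem _ _).2 hz, ne_zero_of_mem_unit_sphere ⟨z, hz1⟩, h⟩

/-- The diagonal operator that scales the coordinates in `T` by `e ^ t`. -/
noncomputable def scaleOn (T : Finset (Fin n)) (t : ℝ) : (Rn n →L[ℝ] Rn n)ˣ :=
  Units.map (Matrix.toEuclideanCLM (n := Fin n) (𝕜 := ℝ) : _ →* _)
    (Units.map (Matrix.diagonalRingHom (Fin n) ℝ).toMonoidHom (MulEquiv.piUnits.symm fun i =>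
      if i ∈ T then Units.mk0 (Real.exp t) (Real.exp_ne_zero t) else 1))

theorem scaleOn_apply (T : Finset (Fin n)) (t : ℝ) (x : Rn n) (i : Fin n) :
    (scaleOn T t : Rn n →L[ℝ] Rn n) x i = if i ∈ T then Real.exp t * x i else x i := by
  by_cases h : i ∈ T <;> simp [scaleOn, Matrix.mulVec_diagonal, MulEquiv.piUnits, h]

theorem costOn_scaleOn (T : Finset (Fin n)) (t : ℝ) (x : Rn n) :
    costOn l1F T ((scaleOn T t : Rn n →L[ℝ] Rn n) x) = Real.exp t * costOn l1F T x := by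
  rw [costOn, costOn, Finset.mul_sum]
  refine Finset.sum_congr rfl fun i hi => ?_
  simp [l1F, scaleOn_apply, hi, abs_mul]

theorem costOn_compl_scaleOn (T : Finset (Fin n)) (t : ℝ) (x : Rn n) :
    costOn l1F Tᶜ ((scaleOn T t : Rn n →L[ℝ] Rn n) x) = costOn l1F Tᶜ x := by
  refine Finset.sum_congr rfl fun i hi => ?_
  rw [scaleOn_apply, if_neg (Finset.mem_compl.1 hi)]

theorem IsTight.le_of_map_scaleOn {s t : ℝ}
    (hs : IsTight T (S.map (scaleOn T s : Rn n →L[ℝ] Rn n).toLinearMap))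
    (ht : IsTight T (S.map (scaleOn T t : Rn n →L[ℝ] Rn n).toLinearMap)) : t ≤ s := by
  obtain ⟨-, _, ⟨z, hz, rfl⟩, hz0, heq⟩ := hs
  have hpos : 0 < costOn l1F T ((scaleOn T s : Rn n →L[ℝ] Rn n) z) :=
    costOn_l1F_pos_of_eq_compl hz0 heq
  have hle : costOn l1F T ((scaleOn T t : Rn n →L[ℝ] Rn n) z) ≤
    costOn l1F Tᶜ ((scaleOn T t : Rn n →L[ℝ] Rn n) z) := ht.1 _ (Submodule.mem_map_of_mem hz)
  have heq : costOn l1F T ((scaleOn T s : Rn n →L[ℝ] Rn n) z) =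
    costOn l1F Tᶜ ((scaleOn T s : Rn n →L[ℝ] Rn n) z) := heq
  rw [costOn_scaleOn] at hpos
  rw [costOn_scaleOn, costOn_compl_scaleOn] at heq hle
  rw [← heq] at hle
  exact Real.exp_le_exp.1
    (le_of_mul_le_mul_right hle (pos_of_mul_pos_right hpos (Real.exp_pos s).le))

theorem pairwise_disjoint_setOf_isTight_scaleOn (T : Finset (Fin n)) {l : ℕ} (ν : Grassmann n l) :
    Pairwise (Function.onFun Disjoint fun t : ℝ =>
      (scaleOn T t * ·) ⁻¹' {g : (Rn n →L[ℝ] Rn n)ˣ | IsTight T (g • ν).plane}) := by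
  refine fun s t hst => Set.disjoint_left.2 fun g hs ht => hst ?_
  simp only [Set.mem_preimage, Set.mem_ofPred_eq, mul_smul, Grassmann.plane_smul (scaleOn T _)]
    at hs ht
  exact (ht.le_of_map_scaleOn hs).antisymm (hs.le_of_map_scaleOn ht)

theorem haar_setOf_isTight {l : ℕ} (hl : l ≤ n) (T : Finset (Fin n)) :
    Grassmann.haar hl {ν | IsTight T ν.plane} = 0 := by
  let η : Measure (Rn n →L[ℝ] Rn n)ˣ := Measure.haar
  let ν := Grassmann.basePlane hl
  have hmeas := (isClosed_setOf_isTight l T).measurableSet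
  have hη : η {g | IsTight T (g • ν).plane} = 0 :=
    measure_eq_zero_of_pairwise_disjoint_preimage_mul η
      ((Grassmann.continuous_smul_left ν).measurable hmeas) (scaleOn T)
      (pairwise_disjoint_setOf_isTight_scaleOn T ν)
  have hmul := Grassmann.measure_setOf_smul_mem_eq_haar_mul hl ν η hmeas
  exact (mul_eq_zero.1 (hmul.symm.trans hη)).resolve_right (NeZero.ne _)

end Tight

theorem corollary6_general (n k l : ℕ) (hl : l ≤ n) {F : ℝ → ℝ} (hF : IsSparsenessMeasure F)
    {c : ℝ} (hc : Tendsto (fun x => F x / x) (𝓝[>] 0) (𝓝 c)) :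
    Grassmann.haar hl (ercSet F n k l) = Grassmann.haar hl (ercSet l1F n k l) := by
  refine (measure_eq_measure_of_null_sdiff (hF.ercSet_l1F_subset n k l) ?_).symm
  refine measure_mono_null (hF.ercSet_diff_subset hc n k l) ?_
  exact measure_iUnion_null fun T => haar_setOf_isTight hl T

theorem corollary6 (n k l : ℕ) (hl : l ≤ n) (α : ℝ) (hα : 0 < α) :
    Grassmann.haar hl (ercSet (zapF α) n k l) = Grassmann.haar hl (ercSet l1F n k l) :=
  corollary6_general n k l hl (isSparsenessMeasure_zapF hα) (tendsto_zapF_div hα)
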